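/- Let $q$ be a prime and let $\mathcal{E}=(L|K,v)$ be an extension of valued fields: $v$ is a (Krull) valuation on $L$, and $K$ carries its restriction. Write $vL\supseteq vK$ for the value groups, $Kv$ for the residue field of $K$, $\mathcal{O}_L,\mathcal{O}_K$ for the valuation rings and $\mathcal{M}_L$ for the maximal ideal of $\mathcal{O}_L$. Assume that $L|K$ is a Kummer extension of degree $q$ (that is, $K$ contains a primitive $q$-th root of unity, $[L:K]=q$, and $L=K(\eta)$ for some $\eta$ with $\eta^q\in K$), that $(vL:vK)=q$, and that $q\neq\operatorname{char} Kv$. Let $H_{\mathcal{E}}$ be the largest convex subgroup of $vL$ that is also a convex subgroup of $vK$, let $\mathcal{O}_{\mathcal{E}}=\{b\in L\mid \exists\,\alpha\in H_{\mathcal{E}}:\ \alpha\le vb\}$ (with $v0=\infty$) be the associated coarsening of $\mathcal{O}_L$, and let $\mathcal{M}_{\mathcal{E}}\subseteq\mathcal{O}_L$ be the maximal ideal of $\mathcal{O}_{\mathcal{E}}$. Assume that the module of Kähler differentials $\Omega_{\mathcal{O}_L|\mathcal{O}_K}$ is nonzero. Then $\mathcal{M}_{\mathcal{E}}$ is a principal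 $\mathcal{O}_{\mathcal{E}}$-ideal, and the annihilator of the $\mathcal{O}_L$-module $\Omega_{\mathcal{O}_L|\mathcal{O}_K}$ is $$\operatorname{ann}\,\Omega_{\mathcal{O}_L|\mathcal{O}_K}=\mathcal{M}_{\mathcal{E}}^{\,q-1}.$$ Further, $\operatorname{ann}\,\Omega_{\mathcal{O}_L|\mathcal{O}_K}=\mathcal{M}_L$ if and only if $q=2$ and $\mathcal{M}_{\mathcal{E}}=\mathcal{M}_L$. -/

import Mathlib

open scoped KaehlerDifferential

section OrderedGroups

variable {G : Type*} [CommGroup G] [LinearOrder G]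

/-- `H` is a convex subgroup of the subgroup `Γ` of an ordered abelian group
(written multiplicatively). -/
structure IsConvexSubgroup (Γ H : Subgroup G) : Prop where
  le : H ≤ Γ
  convex : ∀ a ∈ H, ∀ c ∈ H, ∀ b ∈ Γ, a ≤ b → b ≤ c → b ∈ H

/-- For `Δ ≤ Γ`: the largest convex subgroup of `Γ` that is also a convex subgroup of `Δ`
(see `isGreatest_largestCommonConvex`). -/
def largestCommonConvex (Δ Γ : Subgroup G) : Subgroup G :=
  sSup {H | IsConvexSubgroup Γ H ∧ IsConvexSubgroup Δ H}

variable [IsOrderedMonoid G]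

lemma IsConvexSubgroup.total {Γ H H' : Subgroup G} (h : IsConvexSubgroup Γ H)
    (h' : IsConvexSubgroup Γ H') : H ≤ H' ∨ H' ≤ H := by
  by_contra! hc
  obtain ⟨⟨x, hx, hx'⟩, ⟨y, hy, hy'⟩⟩ :=
    And.intro (SetLike.not_le_iff_exists.1 hc.1) (SetLike.not_le_iff_exists.1 hc.2)
  wlog hx1 : 1 ≤ x generalizing x
  · exact this x⁻¹ (H.inv_mem hx) (by simpa using hx') (by simpa using (le_of_not_ge hx1))
  wlog hy1 : 1 ≤ y generalizing y
  · exact this y⁻¹ (H'.inv_mem hy) (by simpa using hy') (by simpa using (le_of_not_ge hy1))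
  rcases le_total x y with hxy | hxy
  · exact hx' (h'.convex 1 H'.one_mem y hy x (h.le hx) hx1 hxy)
  · exact hy' (h.convex 1 H.one_mem x hx y (h'.le hy) hy1 hxy)

lemma mem_largestCommonConvex {Δ Γ : Subgroup G} {x : G} :
    x ∈ largestCommonConvex Δ Γ ↔
      ∃ H : Subgroup G, (IsConvexSubgroup Γ H ∧ IsConvexSubgroup Δ H) ∧ x ∈ H := by
  refine Subgroup.mem_sSup_of_directedOn ?_ ?_
  · have hbot : ∀ Θ : Subgroup G, IsConvexSubgroup Θ ⊥ := fun Θ =>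
      ⟨bot_le, fun a ha c hc b _ hab hbc => by
        rw [Subgroup.mem_bot] at *
        subst ha; subst hc; exact le_antisymm hbc hab⟩
    exact ⟨⊥, hbot Γ, hbot Δ⟩
  · intro H hH H' hH'
    rcases hH.1.total hH'.1 with h | h
    · exact ⟨H', hH', h, le_rfl⟩
    · exact ⟨H, hH, le_rfl, h⟩

theorem isGreatest_largestCommonConvex (Δ Γ : Subgroup G) :
    IsGreatest {H | IsConvexSubgroup Γ H ∧ IsConvexSubgroup Δ H}
      (largestCommonConvex Δ Γ) := by
  have key : ∀ a ∈ largestCommonConvex Δ Γ, ∀ c ∈ largestCommonConvex Δ Γ,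
      ∃ H : Subgroup G, (IsConvexSubgroup Γ H ∧ IsConvexSubgroup Δ H) ∧ a ∈ H ∧ c ∈ H := by
    intro a ha c hc
    obtain ⟨H, hH, ha⟩ := mem_largestCommonConvex.1 ha
    obtain ⟨H', hH', hc⟩ := mem_largestCommonConvex.1 hc
    rcases hH.1.total hH'.1 with h | h
    · exact ⟨H', hH', h ha, hc⟩
    · exact ⟨H, hH, ha, h hc⟩
  refine ⟨⟨⟨sSup_le fun H hH => hH.1.le, ?_⟩, ⟨sSup_le fun H hH => hH.2.le, ?_⟩⟩,
    fun H hH => le_sSup hH⟩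
  · intro a ha c hc b hb hab hbc
    obtain ⟨H, hH, ha, hc⟩ := key a ha c hc
    exact mem_largestCommonConvex.2 ⟨H, hH, hH.1.convex a ha c hc b hb hab hbc⟩
  · intro a ha c hc b hb hab hbc
    obtain ⟨H, hH, ha, hc⟩ := key a ha c hc
    exact mem_largestCommonConvex.2 ⟨H, hH, hH.2.convex a ha c hc b hb hab hbc⟩

end OrderedGroups

namespace ValuedExt

section Coarsening

variable {L Γ₀ : Type*} [Field L] [LinearOrderedCommGroupWithZero Γ₀]

/-- The coarsening of the valuation ring of `v` associated with a (convex) subgroup `H` of the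
value group: the elements `b` with `v b ≤ α` for some `α ∈ H` (`v` is written
multiplicatively, so small values are the positive ones of the additive notation). -/
def coarsening (v : Valuation L Γ₀) (H : Subgroup Γ₀ˣ) : ValuationSubring L where
  carrier := {b | ∃ α ∈ H, v b ≤ (α : Γ₀)}
  zero_mem' := ⟨1, H.one_mem, by simp⟩
  one_mem' := ⟨1, H.one_mem, by simp⟩
  neg_mem' := by
    rintro b ⟨α, hα, h⟩
    exact ⟨α, hα, by rwa [Valuation.map_neg]⟩
  mul_mem' := by
    rintro b c ⟨α, hα, hb⟩ ⟨β, hβ, hc⟩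
    exact ⟨α * β, H.mul_mem hα hβ, by
      rw [map_mul, Units.val_mul]; exact mul_le_mul' hb hc⟩
  add_mem' := by
    rintro b c ⟨α, hα, hb⟩ ⟨β, hβ, hc⟩
    rcases le_total α β with h | h
    · exact ⟨β, hβ, v.map_add_le (hb.trans (Units.val_le_val.2 h)) hc⟩
    · exact ⟨α, hα, v.map_add_le hb (hc.trans (Units.val_le_val.2 h))⟩
  mem_or_inv_mem' := by
    intro b
    rcases le_total (v b) 1 with h | h
    · exact Or.inl ⟨1, H.one_mem, by simpa using h⟩
    · exact Or.inr ⟨1, H.one_mem, by simpa using inv_le_one_of_one_le₀ h⟩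

lemma le_coarsening (v : Valuation L Γ₀) (H : Subgroup Γ₀ˣ) :
    v.valuationSubring ≤ coarsening v H := fun _ hb => ⟨1, H.one_mem, by simpa using hb⟩

end Coarsening

section Extension

variable (K : Type*) {L Γ₀ : Type*} [Field K] [Field L] [Algebra K L]
  [LinearOrderedCommGroupWithZero Γ₀] (v : Valuation L Γ₀)

/-- The restriction of `v` to `K`. -/
abbrev restr : Valuation K Γ₀ := v.comap (algebraMap K L)

instance : (restr K v).HasExtension v := ⟨fun _ _ => Iff.rfl⟩

/-- The value group `vL`. -/
abbrev valL : Subgroup Γ₀ˣ := MonoidWithZeroHom.valueGroup v.toMonoidWithZeroHom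

/-- The value group `vK`, as a subgroup of the ordered group in which `v` takes its values. -/
abbrev valK : Subgroup Γ₀ˣ := MonoidWithZeroHom.valueGroup (restr K v).toMonoidWithZeroHom

/-- The subgroup `H_E` of the extension `E = (L|K,v)`. -/
def HE : Subgroup Γ₀ˣ := largestCommonConvex (valK K v) (valL v)

/-- The valuation ring `O_E`, with value group `vL / H_E`. -/
def OE : ValuationSubring L := coarsening v (HE K v)

/-- The maximal ideal `M_E` of `O_E`, as an ideal of `O_E`. -/
def ME : Ideal (OE K v) := IsLocalRing.maximalIdeal (OE K v)

/-- The maximal ideal `M_E` of `O_E`, regarded as an ideal of `O_L`. -/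
def MEL : Ideal v.valuationSubring :=
  v.valuationSubring.idealOfLE (OE K v) (le_coarsening v (HE K v))

/-- No element is lost in `MEL`: the set `M_E` is contained in `O_L`. -/
lemma mem_valuationSubring_of_mem_ME {x : OE K v} (hx : x ∈ ME K v) :
    (x : L) ∈ v.valuationSubring := by
  by_contra h
  refine (IsLocalRing.mem_maximalIdeal x).1 hx ?_
  have hx0 : (x : L) ≠ 0 := fun h0 => h (h0 ▸ zero_mem _)
  have hi : (x : L)⁻¹ ∈ OE K v :=
    le_coarsening v _ ((v.valuationSubring.mem_or_inv_mem (x : L)).resolve_left h)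
  exact IsUnit.of_mul_eq_one ⟨_, hi⟩ (Subtype.ext (mul_inv_cancel₀ hx0))

end Extension

/-- `L|K` is a Kummer extension of degree `q`: the field `K` contains a primitive `q`-th root of
unity, `[L:K] = q`, and `L` is generated over `K` by an element whose `q`-th power is in `K`. -/
structure IsKummer (K L : Type*) [Field K] [Field L] [Algebra K L] (q : ℕ) : Prop where
  root : ∃ ζ : K, IsPrimitiveRoot ζ q
  degree : Module.finrank K L = q
  generator : ∃ η : L, η ^ q ∈ (algebraMap K L).range ∧ IntermediateField.adjoin K {η} = ⊤

end ValuedExt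

/-! Values are written multiplicatively, so positive additive value means `v x < 1`. If `w` is
`Ramified`, its value generates vL/vK, so 1, w, …, w^(q-1) have values in distinct cosets and no
cancellation occurs in a sum of terms a_i w^i (`Ramified.term_le_sum`). Projecting to Galois
eigenspaces, which is harmless because `v q = 1`, yields a ramified w with w^q ∈ K
(`exists_isRamifiedRoot`). When such a w is integral, q w^(q-1) dw = d(w^q) = 0, hence w^(q-1) dw =
0.

By maximality of H_E, every element of M_E is bounded by a ramified root of value < 1
(`IsRamifiedRoot.exists_ge`). If no such root generates M_E, the bounds improve to arbitrarily high
powers of roots, and since O_L = O_K + M_E all differentials vanish. So Ω ≠ 0 gives a root t with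
M_E = t O_E (`IsRamifiedRoot.exists_isUniformizingRoot`).

Rescaling t by an element of K with value in H_E shows that M_E^(q-1) kills Ω
(`MEL_pow_le_annihilator`). Conversely a t^i ↦ i a t^i is a derivation of O_L into O_L/M_E^q fixing
the class of t, so b dt = 0 forces bt ∈ M_E^q, that is b ∈ M_E^(q-1) (`annihilator_eq`). -/

namespace ValuedExt

/-! ### Value groups and expansions in powers of a ramified element -/

section ValueGroups

variable {K L Γ₀ : Type*} [Field K] [Field L] [Algebra K L]
  [LinearOrderedCommGroupWithZero Γ₀] {v : Valuation L Γ₀} {q : ℕ}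

lemma mem_valL {u : Γ₀ˣ} : u ∈ valL v ↔ ∃ x, v x = u := by
  rw [valL, MonoidWithZeroHom.mem_valueGroup_iff_of_comm]
  constructor
  · rintro ⟨a, ha, x, hx⟩
    refine ⟨x / a, ?_⟩
    have ha' : v a ≠ 0 := ha
    have hx' : v a * u = v x := hx
    rw [map_div₀, ← hx', mul_div_cancel_left₀ _ ha']
  · rintro ⟨x, hx⟩
    exact ⟨1, by simp, x, by simpa using hx.symm⟩

lemma mem_valK {u : Γ₀ˣ} : u ∈ valK K v ↔ ∃ a : K, v (algebraMap K L a) = u :=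
  mem_valL (v := restr K v)

variable (K v) in
/-- The value of `x` is not the value of an element of `K`. -/
def Ramified (x : L) : Prop := ∀ a : K, v (algebraMap K L a) ≠ v x

lemma Ramified.ne_zero {x : L} (hx : Ramified K v x) : x ≠ 0 := by
  rintro rfl
  exact hx 0 (by simp)

lemma exists_ramified (hq : q.Prime) (hram : (valK K v).relIndex (valL v) = q) :
    ∃ x, Ramified K v x := by
  by_contra! h
  refine hq.one_lt.ne' (hram ▸ Subgroup.relIndex_eq_one.2 fun u hu => ?_)
  obtain ⟨x, hx⟩ := mem_valL.1 hu
  have := h x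
  simp only [Ramified, not_forall, not_not] at this
  obtain ⟨a, ha⟩ := this
  exact mem_valK.2 ⟨a, ha.trans hx⟩

/-- The group vL/vK has prime order q, so the nontrivial class of v x has order exactly q. -/
lemma Ramified.pow (hq : q.Prime) (hram : (valK K v).relIndex (valL v) = q) {x : L}
    (hx : Ramified K v x) {n : ℕ} (hn : ¬ q ∣ n) (a : K) : v (algebraMap K L a) ≠ v x ^ n := by
  intro h
  have hvx : v x ≠ 0 := v.ne_zero_iff.2 hx.ne_zero
  obtain ⟨u, hu⟩ : ∃ u : Γ₀ˣ, (u : Γ₀) = v x := ⟨Units.mk0 _ hvx, rfl⟩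
  have hun : u ^ n ∈ valK K v := mem_valK.2 ⟨a, by simp [h, hu]⟩
  have huL : u ∈ valL v := mem_valL.2 ⟨x, hu.symm⟩
  have huq : u ^ q ∈ valK K v := by
    have := Subgroup.pow_index_mem ((valK K v).subgroupOf (valL v)) ⟨u, huL⟩
    rw [show ((valK K v).subgroupOf (valL v)).index = q from hram] at this
    simpa [Subgroup.mem_subgroupOf] using this
  have hu1 : u ^ ((q.gcd n : ℕ) : ℤ) ∈ valK K v := by
    rw [Nat.gcd_eq_gcd_ab, zpow_add, zpow_mul, zpow_mul, zpow_natCast, zpow_natCast]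
    exact mul_mem (zpow_mem huq _) (zpow_mem hun _)
  rw [(Nat.Prime.coprime_iff_not_dvd hq).2 hn] at hu1
  obtain ⟨b, hb⟩ := mem_valK.1 (by simpa using hu1)
  exact hx b (hb.trans hu)

/-- The nonzero terms have values in pairwise distinct cosets of vK, so the largest one is attained
only once and is the value of the sum. -/
lemma Ramified.term_le_sum (hq : q.Prime) (hram : (valK K v).relIndex (valL v) = q) {w : L}
    (hw : Ramified K v w) (a : Fin q → K) (i : Fin q) :
    v (a i • w ^ (i : ℕ)) ≤ v (∑ j, a j • w ^ (j : ℕ)) := by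
  have : Nonempty (Fin q) := ⟨i⟩
  obtain ⟨m, -, hm⟩ := Finset.exists_max_image Finset.univ
    (fun j : Fin q => v (a j • w ^ (j : ℕ))) Finset.univ_nonempty
  refine (hm i (Finset.mem_univ _)).trans ?_
  by_cases h0 : v (a m • w ^ (m : ℕ)) = 0
  · rw [h0]; exact zero_le
  refine (v.map_sum_eq_of_lt (f := fun j : Fin q => a j • w ^ (j : ℕ)) (Finset.mem_univ m) ?_).ge
  intro j hj
  have hjm : j ≠ m := by simpa using hj
  refine lt_of_le_of_ne (hm j (Finset.mem_univ _)) fun he => ?_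
  -- Two nonzero terms of equal value would put v w ^ (m - j) into vK, although 0 < m - j < q.
  have key : ∀ (j m : Fin q), j < m → v (a j • w ^ (j : ℕ)) = v (a m • w ^ (m : ℕ)) →
      v (a m • w ^ (m : ℕ)) ≠ 0 → False := by
    intro j m hlt he h0
    have hw0 : v w ≠ 0 := v.ne_zero_iff.2 hw.ne_zero
    simp only [Algebra.smul_def, map_mul, map_pow] at he h0
    have ham := left_ne_zero_of_mul h0
    have hd : ¬ q ∣ (m - j : ℕ) := Nat.not_dvd_of_pos_of_lt (by omega) (by omega)
    refine hw.pow hq hram hd (a j / a m) ?_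
    rw [map_div₀, map_div₀, div_eq_iff ham, mul_comm]
    refine mul_right_cancel₀ (pow_ne_zero (j : ℕ) hw0) ?_
    rw [he, mul_assoc, ← pow_add, Nat.sub_add_cancel hlt.le]
  rcases lt_or_gt_of_ne hjm with h | h
  · exact key j m h he h0
  · exact key m j h he.symm (he ▸ h0)

lemma Ramified.linearIndependent (hq : q.Prime) (hram : (valK K v).relIndex (valL v) = q) {w : L}
    (hw : Ramified K v w) : LinearIndependent K fun i : Fin q => w ^ (i : ℕ) := by
  rw [Fintype.linearIndependent_iff]
  intro g hg i
  have := hw.term_le_sum hq hram g i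
  rw [hg, map_zero, le_zero_iff, Valuation.zero_iff, smul_eq_zero] at this
  exact this.resolve_right (pow_ne_zero _ hw.ne_zero)

lemma exists_eq_sum_of_linearIndependent (hq : q.Prime) (hdeg : Module.finrank K L = q) {w : L}
    (h : LinearIndependent K fun i : Fin q => w ^ (i : ℕ)) (x : L) :
    ∃ a : Fin q → K, x = ∑ i, a i • w ^ (i : ℕ) := by
  have : Nonempty (Fin q) := ⟨⟨0, hq.pos⟩⟩
  let b := basisOfLinearIndependentOfCardEqFinrank h (by simp [hdeg])
  refine ⟨b.repr x, ?_⟩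
  conv_lhs => rw [← b.sum_repr x]
  simp [b]

lemma Ramified.exists_eq_sum (hq : q.Prime) (hram : (valK K v).relIndex (valL v) = q)
    (hdeg : Module.finrank K L = q) {w : L} (hw : Ramified K v w) (x : L) :
    ∃ a : Fin q → K, x = ∑ i, a i • w ^ (i : ℕ) :=
  exists_eq_sum_of_linearIndependent hq hdeg (hw.linearIndependent hq hram) x

variable (K) in
-- The assumption on the residue characteristic enters the argument only through this equality.
lemma map_natCast_eq_one (hq : q.Prime)
    (hchar : q ≠ ringChar (IsLocalRing.ResidueField (restr K v).valuationSubring)) :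
    v (q : L) = 1 := by
  have h0 : (q : IsLocalRing.ResidueField (restr K v).valuationSubring) ≠ 0 := by
    intro h
    rcases (Nat.dvd_prime hq).1 ((ringChar.spec _ q).1 h) with h1 | h1
    · exact CharP.ringChar_ne_one h1
    · exact hchar h1.symm
  have hu : IsUnit ((q : ℕ) : (restr K v).valuationSubring) := by
    rw [← IsLocalRing.residue_ne_zero_iff_isUnit]
    simpa using h0
  have := (ValuationSubring.valuation_eq_one_iff _ _).1 hu
  rw [← (Valuation.isEquiv_valuation_valuationSubring (restr K v)).eq_one_iff_eq_one] at this
  simpa using this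

end ValueGroups

/-! ### Existence of a Kummer generator with value outside vK -/

section RamifiedRoots

variable {K L Γ₀ : Type*} [Field K] [Field L] [Algebra K L]
  [LinearOrderedCommGroupWithZero Γ₀] {v : Valuation L Γ₀} {q : ℕ}

variable (K v q) in
/-- A Kummer generator whose value is not in the value group of `K`. -/
structure IsRamifiedRoot (w : L) : Prop where
  pow_mem : w ^ q ∈ (algebraMap K L).range
  ramified : Ramified K v w

/-- Root bound for a monic equation: the coefficient of degree i has value at most v x ^ (q - i), so
for v y > v x the leading term would strictly dominate all others. -/
lemma map_le_of_pow_eq_sum {a : Fin q → K} {x y : L} (hx : x ≠ 0)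
    (ha : ∀ i : Fin q, v (a i • x ^ (i : ℕ)) ≤ v x ^ q) (hy : y ^ q = ∑ i, a i • y ^ (i : ℕ)) :
    v y ≤ v x := by
  by_contra! h
  have hx0 : v x ≠ 0 := v.ne_zero_iff.2 hx
  have hxpos : 0 < v x := zero_lt_iff.2 hx0
  have hypos : 0 < v y := hxpos.trans h
  refine absurd (v.map_sum_lt (s := Finset.univ) (f := fun i : Fin q => a i • y ^ (i : ℕ))
    (g := v y ^ q) (pow_ne_zero _ hypos.ne') fun i _ => ?_) ?_
  · have h1 : v (algebraMap K L (a i)) ≤ v x ^ (q - i : ℕ) := by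
      refine le_of_mul_le_mul_right ?_ (pow_pos hxpos (i : ℕ))
      rw [← pow_add, Nat.sub_add_cancel i.2.le, ← map_pow, ← map_mul, ← Algebra.smul_def]
      exact ha i
    rw [Algebra.smul_def, map_mul, map_pow]
    calc _ ≤ v x ^ (q - i : ℕ) * v y ^ (i : ℕ) := by gcongr
      _ < v y ^ (q - i : ℕ) * v y ^ (i : ℕ) :=
        mul_lt_mul_of_pos_right (pow_lt_pow_left₀ h zero_le (by omega)) (pow_pos hypos _)
      _ = v y ^ q := by rw [← pow_add, Nat.sub_add_cancel i.2.le]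
  · simp only [← hy, map_pow, lt_irrefl, not_false_eq_true]

open Polynomial in
-- A ramified x is the sum of its components b_i η^i in the eigenspaces of the Galois group. None of
-- them exceeds x in value, so one has the same value as x, and its q-th power lies in K.
theorem exists_isRamifiedRoot (hq : q.Prime) (hkum : IsKummer K L q)
    (hram : (valK K v).relIndex (valL v) = q) (hq1 : v (q : L) = 1) :
    ∃ w, IsRamifiedRoot K v q w := by
  obtain ⟨x, hx⟩ := exists_ramified hq hram
  obtain ⟨⟨ζ, hζ⟩, hdeg, η, ⟨c, hc⟩, hη⟩ := hkum
  have : FiniteDimensional K L := Module.finite_of_finrank_pos (hdeg ▸ hq.pos)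
  have hnat : (minpoly K η).natDegree = q := by
    rw [(Field.primitive_element_iff_minpoly_natDegree_eq K η).1 hη, hdeg]
  have hmin : minpoly K η = X ^ q - C c := by
    refine (eq_of_monic_of_dvd_of_natDegree_le (minpoly.monic (.of_finite K η))
      (monic_X_pow_sub_C c hq.ne_zero) (minpoly.dvd _ _ ?_) ?_).symm
    · simp [hc]
    · rw [natDegree_X_pow_sub_C, hnat]
  have hli : LinearIndependent K fun i : Fin q => η ^ (i : ℕ) := by
    have := linearIndependent_pow (K := K) η
    rwa [hnat] at this
  obtain ⟨b, hb⟩ := exists_eq_sum_of_linearIndependent hq hdeg hli x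
  obtain ⟨a, ha⟩ := hx.exists_eq_sum hq hram hdeg (x ^ q)
  have hav : ∀ i : Fin q, v (a i • x ^ (i : ℕ)) ≤ v x ^ q := fun i => by
    rw [← map_pow, ha]
    exact hx.term_le_sum hq hram a i
  have hζL : IsPrimitiveRoot (algebraMap K L ζ) q := hζ.map_of_injective (algebraMap K L).injective
  set z := algebraMap K L ζ with hz
  have hz0 : z ≠ 0 := hζL.ne_zero hq.ne_zero
  have hvz : v z = 1 := by
    have : v z ^ q = 1 := by rw [← map_pow, hζL.pow_eq_one, map_one]
    exact (pow_eq_one_iff_of_nonneg zero_le hq.ne_zero).1 this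
  -- the conjugates of `x` have value at most `v x`
  have hconj : ∀ j : ℕ, v (∑ i, b i • (z ^ j * η) ^ (i : ℕ)) ≤ v x := by
    intro j
    let P : K[X] := ∑ i, C (b i) * X ^ (i : ℕ)
    have hP : ∀ y : L, aeval y P = ∑ i, b i • y ^ (i : ℕ) := fun y => by
      simp [P, Algebra.smul_def]
    -- `Q` expresses the degree q equation of x = P(η). It vanishes at η, hence at every conjugate z
    -- ^ j * η.
    let Q : K[X] := P ^ q - ∑ i, C (a i) * P ^ (i : ℕ)
    have hQ : ∀ y : L, aeval y Q = (aeval y P) ^ q - ∑ i, a i • (aeval y P) ^ (i : ℕ) := fun y => by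
      simp [Q, Algebra.smul_def]
    have hdvd : minpoly K η ∣ Q := minpoly.dvd _ _ (by rw [hQ, hP, ← hb, ← ha, sub_self])
    have hroot : aeval (z ^ j * η) (minpoly K η) = 0 := by
      rw [hmin]
      simp only [map_sub, map_pow, aeval_X, aeval_C, mul_pow]
      rw [← pow_mul, mul_comm j, pow_mul, hζL.pow_eq_one, one_pow, one_mul, hc, sub_self]
    have hQ0 := aeval_eq_zero_of_dvd_aeval_eq_zero hdvd hroot
    rw [hQ, sub_eq_zero] at hQ0
    rw [← hP]
    exact map_le_of_pow_eq_sum hx.ne_zero hav hQ0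
  -- hence so have the eigencomponents of `x`
  have hcomp : ∀ i : Fin q, v (b i • η ^ (i : ℕ)) ≤ v x := by
    intro i
    -- This is q times the projection to the i-th eigenspace: the other components are multiplied by
    -- a full sum of powers of a nontrivial q-th root of unity.
    have hsum : ∑ j ∈ Finset.range q, (z⁻¹ ^ (i : ℕ)) ^ j * ∑ k, b k • (z ^ j * η) ^ (k : ℕ) =
        q * (b i • η ^ (i : ℕ)) := by
      simp_rw [Finset.mul_sum]
      rw [Finset.sum_comm, Finset.sum_eq_single i]
      · rw [← nsmul_eq_mul]
        refine (Finset.sum_eq_card_nsmul fun j _ => ?_).trans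
          (congr_arg (· • (b i • η ^ (i : ℕ))) (Finset.card_range q))
        rw [mul_smul_comm, mul_pow, ← mul_assoc, ← pow_mul, ← pow_mul, mul_comm j, ← mul_pow,
          inv_mul_cancel₀ hz0, one_pow, one_mul]
      · intro k _ hki
        have h1 : ∀ j : ℕ, (z⁻¹ ^ (i : ℕ)) ^ j * b k • (z ^ j * η) ^ (k : ℕ) =
            (z⁻¹ ^ (i : ℕ) * z ^ (k : ℕ)) ^ j * (b k • η ^ (k : ℕ)) := fun j => by
          simp only [Algebra.smul_def]; ring
        simp_rw [h1]
        rw [← Finset.sum_mul]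
        have hne : z⁻¹ ^ (i : ℕ) * z ^ (k : ℕ) ≠ 1 := by
          intro h
          rw [inv_pow, inv_mul_eq_one₀ (pow_ne_zero _ hz0)] at h
          exact hki (Fin.ext (hζL.pow_inj i.2 k.2 h).symm)
        have h2 := mul_geom_sum (z⁻¹ ^ (i : ℕ) * z ^ (k : ℕ)) q
        have h3 : (z⁻¹ ^ (i : ℕ) * z ^ (k : ℕ)) ^ q = 1 := by
          rw [mul_pow, ← pow_mul, ← pow_mul, mul_comm, mul_comm (k : ℕ), mul_comm (i : ℕ), pow_mul,
            pow_mul, inv_pow, hζL.pow_eq_one]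
          simp
        rw [h3, sub_self] at h2
        rw [(mul_eq_zero.1 h2).resolve_left (sub_ne_zero.2 hne), zero_mul]
      · simp
    have := congr_arg v hsum
    rw [map_mul, hq1, one_mul] at this
    rw [← this]
    refine v.map_sum_le fun j _ => ?_
    simpa [hvz] using hconj j
  obtain ⟨i, hi⟩ : ∃ i, v x ≤ v (b i • η ^ (i : ℕ)) := by
    by_contra! h
    refine absurd (v.map_sum_lt (s := Finset.univ) (f := fun i : Fin q => b i • η ^ (i : ℕ))
      (v.ne_zero_iff.2 hx.ne_zero) fun i _ => h i) ?_
    rw [← hb]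
    exact lt_irrefl _
  refine ⟨b i • η ^ (i : ℕ), ⟨b i ^ q * c ^ (i : ℕ), ?_⟩, fun y hy => hx y ?_⟩
  · rw [map_mul, map_pow, map_pow, hc, Algebra.smul_def]; ring
  · exact hy.trans (le_antisymm (hcomp i) hi)

end RamifiedRoots

/-! ### The maximal ideal of O_E and its ramified elements -/

section MaximalIdeal

variable {K L Γ₀ : Type*} [Field K] [Field L] [Algebra K L]
  [LinearOrderedCommGroupWithZero Γ₀] {v : Valuation L Γ₀} {q : ℕ}

lemma HE_le_valK {u : Γ₀ˣ} (hu : u ∈ HE K v) : u ∈ valK K v :=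
  (isGreatest_largestCommonConvex (valK K v) (valL v)).1.2.le hu

lemma HE_convex {a c b : Γ₀ˣ} (ha : a ∈ HE K v) (hc : c ∈ HE K v) (hb : b ∈ valL v) (hab : a ≤ b)
    (hbc : b ≤ c) : b ∈ HE K v :=
  (isGreatest_largestCommonConvex (valK K v) (valL v)).1.1.convex a ha c hc b hb hab hbc

lemma mem_OE {x : L} : x ∈ OE K v ↔ ∃ α ∈ HE K v, v x ≤ (α : Γ₀) := Iff.rfl

lemma mem_OE_of_le {x : L} (hx : v x ≤ 1) : x ∈ OE K v := le_coarsening v _ hx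

lemma mem_ME {x : OE K v} : x ∈ ME K v ↔ ∀ α ∈ HE K v, v x < (α : Γ₀) := by
  rw [ME, IsLocalRing.mem_maximalIdeal, mem_nonunits_iff]
  rcases eq_or_ne (x : L) 0 with h0 | h0
  · obtain rfl : x = 0 := Subtype.ext h0
    simp [zero_lt_iff]
  have h1 : IsUnit x ↔ (x : L)⁻¹ ∈ OE K v := by
    constructor
    · rintro ⟨u, rfl⟩
      have : ((u : OE K v) : L) * ((u⁻¹ : (OE K v)ˣ) : OE K v) = 1 := by
        rw [← MulMemClass.coe_mul, Units.mul_inv]; rfl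
      rw [inv_eq_of_mul_eq_one_right this]
      exact SetLike.coe_mem _
    · exact fun h => IsUnit.of_mul_eq_one ⟨_, h⟩ (Subtype.ext (mul_inv_cancel₀ h0))
  have hv : 0 < v (x : L) := zero_lt_iff.2 (v.ne_zero_iff.2 h0)
  rw [h1, mem_OE]
  push Not
  constructor
  · intro h α hα
    have := h α⁻¹ (inv_mem hα)
    rw [map_inv₀, Units.val_inv_eq_inv_val] at this
    exact (inv_lt_inv₀ (zero_lt_iff.2 α.ne_zero) hv).1 this
  · intro h α hα
    have := h α⁻¹ (inv_mem hα)
    rw [Units.val_inv_eq_inv_val] at this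
    rw [map_inv₀]
    exact (lt_inv_comm₀ hv (zero_lt_iff.2 α.ne_zero)).1 this

lemma mem_MEL {x : v.valuationSubring} : x ∈ MEL K v ↔ ∀ α ∈ HE K v, v x < (α : Γ₀) :=
  mem_ME (x := v.valuationSubring.inclusion (OE K v) (le_coarsening v (HE K v)) x)

lemma le_one_of_forall_lt {x : L} (hx : ∀ α ∈ HE K v, v x < (α : Γ₀)) : v x < 1 := by
  simpa using hx 1 (one_mem _)

/-- A ramified element of positive (additive) value lies in `M_E`. -/
lemma Ramified.lt_of_lt_one {w : L} (hw : Ramified K v w) (h1 : v w < 1) {α : Γ₀ˣ}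
    (hα : α ∈ HE K v) : v w < (α : Γ₀) := by
  by_contra! h
  obtain ⟨u, hu⟩ : ∃ u : Γ₀ˣ, (u : Γ₀) = v w := ⟨Units.mk0 _ (v.ne_zero_iff.2 hw.ne_zero), rfl⟩
  have := HE_le_valK (HE_convex hα (one_mem _) (mem_valL.2 ⟨w, hu.symm⟩)
    (Units.val_le_val.1 (hu ▸ h)) (Units.val_le_val.1 (hu ▸ h1.le)))
  obtain ⟨a, ha⟩ := mem_valK.1 this
  exact hw a (ha.trans hu)

lemma ramified_inv {w : L} (hw : Ramified K v w) : Ramified K v w⁻¹ := fun a ha =>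
  hw a⁻¹ (by rw [map_inv₀, map_inv₀, ha, map_inv₀, inv_inv])

lemma Ramified.ne_one {w : L} (hw : Ramified K v w) : v w ≠ 1 := fun h => hw 1 (by simp [h])

/-- Elements of `M_E` are bounded by ramified elements: this uses the maximality of `H_E`. -/
lemma exists_ramified_ge {x : L} (hx0 : x ≠ 0) (hx : ∀ α ∈ HE K v, v x < (α : Γ₀)) :
    ∃ y, Ramified K v y ∧ v y < 1 ∧ v x ≤ v y := by
  by_contra! hcon
  have hx1 : v x < 1 := le_one_of_forall_lt hx
  obtain ⟨u, hu⟩ : ∃ u : Γ₀ˣ, (u : Γ₀) = v x := ⟨Units.mk0 _ (v.ne_zero_iff.2 hx0), rfl⟩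
  have hu1 : u < 1 := Units.val_lt_val.1 (by simpa [hu] using hx1)
  have huL : u ∈ valL v := mem_valL.2 ⟨x, hu.symm⟩
  -- A value in this interval outside vK would come from a ramified element bounding x, contrary to
  -- `hcon`.
  have hstep : ∀ g ∈ valL v, u ≤ g → g ≤ 1 → g ∈ valK K v := by
    intro g hg hug hg1
    obtain ⟨y, hy⟩ := mem_valL.1 hg
    by_contra hgK
    have hyr : Ramified K v y := fun a ha => hgK (mem_valK.2 ⟨a, ha.trans hy⟩)
    refine (hcon y hyr (lt_of_le_of_ne ?_ hyr.ne_one)).not_ge ?_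
    · rw [hy]; exact_mod_cast hg1
    · rw [hy, ← hu]; exact_mod_cast hug
  have huK : u ∈ valK K v := hstep u huL le_rfl hu1.le
  have hpow : ∀ (n : ℕ), ∀ g ∈ valL v, u ^ n ≤ g → g ≤ 1 → g ∈ valK K v := by
    intro n
    induction n with
    | zero =>
      intro g hg h1 h2
      rw [pow_zero] at h1
      rw [le_antisymm h2 h1]; exact one_mem _
    | succ n ih =>
      intro g hg h1 h2
      rcases le_total (u ^ n) g with h | h
      · exact ih g hg h h2
      · have : g * (u ^ n)⁻¹ ∈ valK K v := by
          refine hstep _ (mul_mem hg (inv_mem (pow_mem huL n))) ?_ ?_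
          · rwa [le_mul_inv_iff_mul_le, ← pow_succ']
          · rwa [mul_inv_le_iff_le_mul, one_mul]
        simpa using mul_mem this (pow_mem huK n)
  -- The convex subgroup of vL generated by u = v x. By `hpow` it lies in vK, hence in H_E, which
  -- contradicts x ∈ M_E.
  let H : Subgroup Γ₀ˣ :=
    { carrier := {g | g ∈ valL v ∧ ∃ n : ℕ, u ^ n ≤ g ∧ g ≤ (u ^ n)⁻¹}
      one_mem' := ⟨one_mem _, 0, by simp⟩
      mul_mem' := by
        rintro a b ⟨ha, m, hm1, hm2⟩ ⟨hb, n, hn1, hn2⟩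
        refine ⟨mul_mem ha hb, m + n, ?_, ?_⟩
        · rw [pow_add]; exact mul_le_mul' hm1 hn1
        · rw [pow_add, mul_inv]; exact mul_le_mul' hm2 hn2
      inv_mem' := by
        rintro a ⟨ha, m, hm1, hm2⟩
        exact ⟨inv_mem ha, m, by simpa using inv_le_inv' hm2, by simpa using hm1⟩ }
  have hHK : H ≤ valK K v := by
    rintro g ⟨hg, n, h1, h2⟩
    rcases le_total g 1 with h | h
    · exact hpow n g hg h1 h
    · simpa using inv_mem (hpow n g⁻¹ (inv_mem hg) (by simpa using inv_le_inv' h2) (by simpa using h))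
  have hHL : H ≤ valL v := fun g hg => hg.1
  have hconv : ∀ a ∈ H, ∀ c ∈ H, ∀ b ∈ valL v, a ≤ b → b ≤ c → b ∈ H := by
    rintro a ⟨-, m, hm1, hm2⟩ c ⟨-, n, hn1, hn2⟩ b hb hab hbc
    refine ⟨hb, m + n, ?_, ?_⟩
    · exact (pow_le_pow_right_of_le_one' hu1.le (Nat.le_add_right m n)).trans (hm1.trans hab)
    · exact (hbc.trans hn2).trans
        (inv_le_inv' (pow_le_pow_right_of_le_one' hu1.le (Nat.le_add_left n m)))
  have hKL : valK K v ≤ valL v := fun g hg => by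
    obtain ⟨a, ha⟩ := mem_valK.1 hg
    exact mem_valL.2 ⟨_, ha⟩
  have hHE : H ≤ HE K v := (isGreatest_largestCommonConvex (valK K v) (valL v)).2
    ⟨⟨hHL, hconv⟩, ⟨hHK, fun a ha c hc b hb => hconv a ha c hc b (hKL hb)⟩⟩
  have huH : u ∈ H := ⟨huL, 1, by simp, by simpa using hu1.le.trans (Left.one_le_inv_iff.2 hu1.le)⟩
  exact (hx u (hHE huH)).ne hu.symm

lemma IsRamifiedRoot.inv {w : L} (hw : IsRamifiedRoot K v q w) : IsRamifiedRoot K v q w⁻¹ := by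
  obtain ⟨s, hs⟩ := hw.pow_mem
  exact ⟨⟨s⁻¹, by rw [map_inv₀, hs, inv_pow]⟩, ramified_inv hw.ramified⟩

/-- Elements of `M_E` are bounded by ramified roots. -/
lemma IsRamifiedRoot.exists_ge (hq : q.Prime) (hram : (valK K v).relIndex (valL v) = q)
    (hdeg : Module.finrank K L = q) {η : L} (hη : IsRamifiedRoot K v q η) {x : L}
    (hx : ∀ α ∈ HE K v, v x < (α : Γ₀)) :
    ∃ w, IsRamifiedRoot K v q w ∧ v w < 1 ∧ v x ≤ v w := by
  rcases eq_or_ne x 0 with rfl | hx0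
  · rcases lt_or_gt_of_ne hη.ramified.ne_one with h | h
    · exact ⟨η, hη, h, by simp⟩
    · exact ⟨η⁻¹, hη.inv, by rw [map_inv₀]; exact inv_lt_one_of_one_lt₀ h, by simp⟩
  obtain ⟨y, hy, hy1, hxy⟩ := exists_ramified_ge hx0 hx
  obtain ⟨a, ha⟩ := hη.ramified.exists_eq_sum hq hram hdeg y
  -- Some monomial a_i η^i has the value of y, and the q-th power of every monomial is in K.
  obtain ⟨i, hi⟩ : ∃ i, v y ≤ v (a i • η ^ (i : ℕ)) := by
    by_contra! h
    refine absurd (v.map_sum_lt (s := Finset.univ) (f := fun i : Fin q => a i • η ^ (i : ℕ))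
      (v.ne_zero_iff.2 hy.ne_zero) fun i _ => h i) ?_
    rw [← ha]
    exact lt_irrefl _
  have hvy : v y = v (a i • η ^ (i : ℕ)) := le_antisymm hi (by
    conv_rhs => rw [ha]
    exact hη.ramified.term_le_sum hq hram a i)
  obtain ⟨s, hs⟩ := hη.pow_mem
  refine ⟨a i • η ^ (i : ℕ), ⟨⟨a i ^ q * s ^ (i : ℕ), ?_⟩, fun b hb => hy b (hb.trans hvy.symm)⟩,
    hvy ▸ hy1, hvy ▸ hxy⟩
  rw [map_mul, map_pow, map_pow, hs, Algebra.smul_def]; ring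

end MaximalIdeal

end ValuedExt

/-! ### Differentials of polynomials in a radical element -/

/-- Differentiating w^q = s gives q w^(q-1) dw = 0, and q is a unit; the divisibility makes each i b
a_i w^(i-1) dw a multiple of w^(q-1) dw. -/
lemma KaehlerDifferential.smul_D_sum_eq_zero {A B : Type*} [CommRing A] [CommRing B] [Algebra A B]
    {q : ℕ} (hq : IsUnit (q : B)) {w : B} {s : A} (hw : w ^ q = algebraMap A B s) (a : Fin q → A)
    {b : B} (hb : ∀ i : Fin q, 0 < (i : ℕ) →
      w ^ (q - 1) ∣ b * (algebraMap A B (a i) * w ^ ((i : ℕ) - 1))) :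
    b • KaehlerDifferential.D A B (∑ i, algebraMap A B (a i) * w ^ (i : ℕ)) = 0 := by
  have h0 : w ^ (q - 1) • KaehlerDifferential.D A B w = 0 := by
    have h1 := (KaehlerDifferential.D A B).leibniz_pow w q
    rw [hw, Derivation.map_algebraMap, ← Nat.cast_smul_eq_nsmul B] at h1
    exact (hq.smul_eq_zero.1 h1.symm)
  rw [map_sum, Finset.smul_sum]
  refine Finset.sum_eq_zero fun i _ => ?_
  rw [Derivation.leibniz, Derivation.map_algebraMap, smul_zero, add_zero, Derivation.leibniz_pow]
  rcases Nat.eq_zero_or_pos (i : ℕ) with hi | hi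
  · simp [hi]
  obtain ⟨c, hc⟩ := hb i hi
  rw [smul_comm _ (i : ℕ), smul_comm _ (i : ℕ), smul_smul, smul_smul, ← mul_assoc] at *
  rw [hc, mul_comm, mul_smul, h0, smul_zero, smul_zero]

lemma KaehlerDifferential.mem_annihilator_iff {A B : Type*} [CommRing A] [CommRing B] [Algebra A B]
    {b : B} : b ∈ Module.annihilator B (Ω[B⁄A]) ↔ ∀ x, b • KaehlerDifferential.D A B x = 0 := by
  rw [Module.mem_annihilator]
  refine ⟨fun h x => h _, fun h m => ?_⟩
  have hm : m ∈ Submodule.span B (Set.range (KaehlerDifferential.D A B)) := by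
    rw [KaehlerDifferential.span_range_derivation]; trivial
  induction hm using Submodule.span_induction with
  | mem x hx => obtain ⟨y, rfl⟩ := hx; exact h y
  | zero => exact smul_zero _
  | add x y _ _ hx hy => rw [smul_add, hx, hy, add_zero]
  | smul c x _ hx => rw [smul_comm, hx, smul_zero]

namespace ValuedExt

/-! ### Nonzero differentials force M_E to be principal -/

section Differentials

variable {K L Γ₀ : Type*} [Field K] [Field L] [Algebra K L]
  [LinearOrderedCommGroupWithZero Γ₀] {v : Valuation L Γ₀} {q : ℕ}

lemma Ramified.smul_pow (hq : q.Prime) (hram : (valK K v).relIndex (valL v) = q) {w : L}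
    (hw : Ramified K v w) {a : K} (ha : a ≠ 0) {i : ℕ} (hi : ¬ q ∣ i) :
    Ramified K v (a • w ^ i) := by
  intro b hb
  refine hw.pow hq hram hi (b / a) ?_
  have ha' : v (algebraMap K L a) ≠ 0 := v.ne_zero_iff.2 (by simpa using ha)
  rw [map_div₀, map_div₀, hb, Algebra.smul_def, map_mul, map_pow, mul_div_cancel_left₀ _ ha']

lemma dvd_iff_map_le {x y : v.valuationSubring} : x ∣ y ↔ v (y : L) ≤ v (x : L) :=
  (Valuation.valuationSubring.integers v).dvd_iff_le

lemma isUnit_natCast (hq1 : v (q : L) = 1) : IsUnit (q : v.valuationSubring) :=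
  (Valuation.valuationSubring.integers v).isUnit_iff_valuation_eq_one.2 (by simpa using hq1)

/-- If `1, w, …, w ^ (q - 1)` have small enough coefficients in `x`, then `b` kills `d x`. -/
lemma IsRamifiedRoot.smul_D_eq_zero (hq1 : v (q : L) = 1) {w : L} (hw : IsRamifiedRoot K v q w)
    (hw1 : v w ≤ 1) {a : Fin q → K} (ha : ∀ i, v (algebraMap K L (a i)) ≤ 1)
    {x b : v.valuationSubring} (hx : (x : L) = ∑ i, a i • w ^ (i : ℕ))
    (hb : ∀ i : Fin q, 0 < (i : ℕ) → v b * v (a i • w ^ (i : ℕ)) ≤ v w ^ q) :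
    b • KaehlerDifferential.D (restr K v).valuationSubring v.valuationSubring x = 0 := by
  obtain ⟨s, hs⟩ := hw.pow_mem
  have hs1 : s ∈ (restr K v).valuationSubring := by
    change v (algebraMap K L s) ≤ 1
    rw [hs, map_pow]
    exact pow_le_one' hw1 q
  let w' : v.valuationSubring := ⟨w, hw1⟩
  let a' : Fin q → (restr K v).valuationSubring := fun i => ⟨a i, ha i⟩
  have hx' : x = ∑ i, algebraMap _ v.valuationSubring (a' i) * w' ^ (i : ℕ) := by
    apply Subtype.ext
    simp [hx, a', w', Algebra.smul_def]
  rw [hx']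
  refine KaehlerDifferential.smul_D_sum_eq_zero (isUnit_natCast hq1) (w := w') (s := ⟨s, hs1⟩)
    (Subtype.ext hs.symm) a' fun i hi => ?_
  rw [dvd_iff_map_le]
  have hw0 : 0 < v w := zero_lt_iff.2 (v.ne_zero_iff.2 hw.ramified.ne_zero)
  refine le_of_mul_le_mul_right ?_ hw0
  have := hb i hi
  rw [Algebra.smul_def] at this
  calc v ((b * (algebraMap _ v.valuationSubring (a' i) * w' ^ ((i : ℕ) - 1)) :
        v.valuationSubring) : L) * v w = v b * v (algebraMap K L (a i) * w ^ (i : ℕ)) := by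
        simp only [map_mul, map_pow, MulMemClass.coe_mul, SubmonoidClass.coe_pow, a', w',
          Valuation.HasExtension.coe_algebraMap_valuationSubring_eq]
        rw [mul_assoc, mul_assoc, ← pow_succ, Nat.sub_add_cancel hi]
    _ ≤ v w ^ q := this
    _ = v ((w' ^ (q - 1) : v.valuationSubring) : L) * v w := by
        simp only [map_pow, SubmonoidClass.coe_pow, w']
        rw [← pow_succ, Nat.sub_add_cancel (by omega)]

/-- `O_L = O_K + M_E`. -/
lemma IsRamifiedRoot.exists_sub_mem (hq : q.Prime) (hram : (valK K v).relIndex (valL v) = q)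
    (hdeg : Module.finrank K L = q) {η : L} (hη : IsRamifiedRoot K v q η)
    (x : v.valuationSubring) :
    ∃ a : (restr K v).valuationSubring, ∀ α ∈ HE K v,
      v ((x - algebraMap _ v.valuationSubring a : v.valuationSubring) : L) < (α : Γ₀) := by
  obtain ⟨a, ha⟩ := hη.ramified.exists_eq_sum hq hram hdeg (x : L)
  have hle : ∀ i, v (a i • η ^ (i : ℕ)) ≤ 1 := fun i =>
    (hη.ramified.term_le_sum hq hram a i).trans (ha ▸ x.2)
  let i0 : Fin q := ⟨0, hq.pos⟩
  have h0 := hle i0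
  simp only [i0, pow_zero, Algebra.smul_def, mul_one] at h0
  refine ⟨⟨a i0, h0⟩, fun α hα => ?_⟩
  have hsub : ((x - algebraMap (restr K v).valuationSubring v.valuationSubring ⟨a i0, h0⟩ : v.valuationSubring) : L) =
      ∑ i ∈ Finset.univ.erase i0, a i • η ^ (i : ℕ) := by
    rw [Finset.sum_erase_eq_sub (Finset.mem_univ _), ← ha]
    simp [i0, Algebra.smul_def]
  rw [hsub]
  refine v.map_sum_lt α.ne_zero fun i hi => ?_
  by_cases hai : a i = 0
  · simp [hai, zero_lt_iff]
  have hi0 : (i : ℕ) ≠ 0 := fun h => (Finset.ne_of_mem_erase hi) (Fin.ext h)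
  have hr : Ramified K v (a i • η ^ (i : ℕ)) := hη.ramified.smul_pow hq hram hai
    (Nat.not_dvd_of_pos_of_lt (Nat.pos_of_ne_zero hi0) i.2)
  exact hr.lt_of_lt_one (lt_of_le_of_ne (hle i) hr.ne_one) hα

variable (K v q) in
/-- A ramified root generating the maximal ideal of `O_E`. -/
structure IsUniformizingRoot (t : L) : Prop extends IsRamifiedRoot K v q t where
  lt_one : v t < 1
  le_mul : ∀ y : L, (∀ α ∈ HE K v, v y < (α : Γ₀)) → ∃ α ∈ HE K v, v y ≤ v t * (α : Γ₀)

/-- If no ramified root generates `M_E`, then `M_E` is idempotent: its elements are bounded by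
arbitrarily high powers of ramified roots in `M_E`. -/
lemma IsRamifiedRoot.exists_ge_pow (hq : q.Prime) (hram : (valK K v).relIndex (valL v) = q)
    (hdeg : Module.finrank K L = q) {η : L} (hη : IsRamifiedRoot K v q η)
    (hnot : ∀ t, ¬ IsUniformizingRoot K v q t) {x : L} (hx : ∀ α ∈ HE K v, v x < (α : Γ₀))
    (n : ℕ) : ∃ w, IsRamifiedRoot K v q w ∧ v w < 1 ∧ v x ≤ v w ^ (2 ^ n) := by
  induction n with
  | zero => simpa using hη.exists_ge hq hram hdeg hx
  | succ n ih =>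
    obtain ⟨w, hw, hw1, hxw⟩ := ih
    -- As w does not generate M_E, some y ∈ M_E lies outside w O_E. Then w = y * (w / y) has both
    -- factors in M_E, and the larger of two roots bounding them doubles the exponent.
    obtain ⟨y, hy, hyw⟩ : ∃ y : L, (∀ α ∈ HE K v, v y < (α : Γ₀)) ∧
        ∀ α ∈ HE K v, v w * (α : Γ₀) < v y := by
      by_contra! h
      exact hnot w ⟨hw, hw1, h⟩
    have hwpos : 0 < v w := zero_lt_iff.2 (v.ne_zero_iff.2 hw.ramified.ne_zero)
    have hypos : 0 < v y := hwpos.trans (by simpa using hyw 1 (one_mem _))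
    have hz : ∀ α ∈ HE K v, v (w / y) < (α : Γ₀) := fun α hα => by
      have := hyw α⁻¹ (inv_mem hα)
      rw [Units.val_inv_eq_inv_val, ← div_eq_mul_inv, div_lt_iff₀ (zero_lt_iff.2 α.ne_zero)] at this
      rw [map_div₀, div_lt_iff₀ hypos, mul_comm]
      exact this
    obtain ⟨w1, hw1r, hw11, hyw1⟩ := hη.exists_ge hq hram hdeg hy
    obtain ⟨w2, hw2r, hw21, hyw2⟩ := hη.exists_ge hq hram hdeg hz
    have key : ∀ u : L, v w1 ≤ v u → v w2 ≤ v u → v x ≤ v u ^ (2 ^ (n + 1)) := fun u h1 h2 => by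
      have : v w ≤ v u ^ 2 := by
        calc v w = v y * v (w / y) := by
              rw [← map_mul, mul_div_cancel₀ _ (v.ne_zero_iff.1 hypos.ne')]
          _ ≤ v u * v u := mul_le_mul' (hyw1.trans h1) (hyw2.trans h2)
          _ = v u ^ 2 := (sq _).symm
      calc v x ≤ v w ^ (2 ^ n) := hxw
        _ ≤ (v u ^ 2) ^ (2 ^ n) := pow_le_pow_left₀ zero_le this _
        _ = v u ^ (2 ^ (n + 1)) := by rw [← pow_mul, pow_succ']
    rcases le_total (v w1) (v w2) with h | h
    · exact ⟨w2, hw2r, hw21, key w2 h le_rfl⟩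
    · exact ⟨w1, hw1r, hw11, key w1 le_rfl h⟩

/-- If there are nonzero differentials, then `M_E` is generated by a ramified root. -/
theorem IsRamifiedRoot.exists_isUniformizingRoot (hq : q.Prime)
    (hram : (valK K v).relIndex (valL v) = q)
    (hdeg : Module.finrank K L = q) (hq1 : v (q : L) = 1) {η : L} (hη : IsRamifiedRoot K v q η)
    (hΩ : Nontrivial (Ω[v.valuationSubring⁄(restr K v).valuationSubring])) :
    ∃ t, IsUniformizingRoot K v q t := by
  by_contra! hnot
  have h1 : (1 : v.valuationSubring) ∈ Module.annihilator v.valuationSubring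
      (Ω[v.valuationSubring⁄(restr K v).valuationSubring]) := by
    rw [KaehlerDifferential.mem_annihilator_iff]
    intro x
    obtain ⟨c, hc⟩ := hη.exists_sub_mem hq hram hdeg x
    set y := x - algebraMap _ v.valuationSubring c with hy
    have hxy : x = y + algebraMap _ v.valuationSubring c := by rw [hy, sub_add_cancel]
    rw [hxy, map_add, Derivation.map_algebraMap, add_zero]
    obtain ⟨w, hw, hw1, hyw⟩ := hη.exists_ge_pow hq hram hdeg hnot hc q
    replace hyw : v (y : L) ≤ v w ^ q :=
      hyw.trans (pow_le_pow_right_of_le_one' hw1.le Nat.lt_two_pow_self.le)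
    obtain ⟨a, ha⟩ := hw.ramified.exists_eq_sum hq hram hdeg (y : L)
    -- With y bounded by v w ^ q, every term is so small that even b = 1 kills dy.
    have hle : ∀ i, v (a i • w ^ (i : ℕ)) ≤ v w ^ q := fun i =>
      (hw.ramified.term_le_sum hq hram a i).trans (ha ▸ hyw)
    refine hw.smul_D_eq_zero hq1 hw1.le (fun i => ?_) ha fun i _ => by simpa using hle i
    have hwpos : 0 < v w := zero_lt_iff.2 (v.ne_zero_iff.2 hw.ramified.ne_zero)
    refine le_of_mul_le_mul_right ?_ (pow_pos hwpos (i : ℕ))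
    rw [one_mul, ← map_pow, ← map_mul, ← Algebra.smul_def, map_pow]
    exact (hle i).trans (pow_le_pow_right_of_le_one' hw1.le i.2.le)
  rw [Module.mem_annihilator] at h1
  obtain ⟨m, hm⟩ := exists_ne (0 : Ω[v.valuationSubring⁄(restr K v).valuationSubring])
  exact hm (by simpa using h1 m)

end Differentials

/-! ### Powers of M_E annihilate the differentials -/

section Uniformizing

variable {K L Γ₀ : Type*} [Field K] [Field L] [Algebra K L]
  [LinearOrderedCommGroupWithZero Γ₀] {v : Valuation L Γ₀} {q : ℕ}

lemma exists_map_eq_of_mem_HE {u : Γ₀ˣ} (hu : u ∈ HE K v) :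
    ∃ c : K, v (algebraMap K L c) = u :=
  mem_valK.1 (HE_le_valK hu)

lemma div_mem_OE {x y : L} (hy : y ≠ 0) :
    x / y ∈ OE K v ↔ ∃ α ∈ HE K v, v x ≤ v y * (α : Γ₀) := by
  rw [mem_OE]
  simp only [map_div₀, div_le_iff₀ (zero_lt_iff.2 (v.ne_zero_iff.2 hy)), mul_comm]

namespace IsUniformizingRoot

variable {t : L}

lemma ne_zero (ht : IsUniformizingRoot K v q t) : t ≠ 0 := ht.ramified.ne_zero

lemma map_pos (ht : IsUniformizingRoot K v q t) : 0 < v t :=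
  zero_lt_iff.2 (v.ne_zero_iff.2 ht.ne_zero)

lemma lt_HE (ht : IsUniformizingRoot K v q t) {α : Γ₀ˣ} (hα : α ∈ HE K v) : v t < (α : Γ₀) :=
  ht.ramified.lt_of_lt_one ht.lt_one hα

lemma isPrincipal_ME (ht : IsUniformizingRoot K v q t) : (ME K v).IsPrincipal := by
  have htO : t ∈ OE K v := mem_OE_of_le ht.lt_one.le
  refine ⟨⟨⟨t, htO⟩, le_antisymm (fun y hy => ?_) ?_⟩⟩
  · refine Ideal.mem_span_singleton'.2
      ⟨⟨y / t, (div_mem_OE ht.ne_zero).2 (ht.le_mul y (mem_ME.1 hy))⟩, Subtype.ext ?_⟩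
    exact div_mul_cancel₀ _ ht.ne_zero
  · exact (Ideal.span_singleton_le_iff_mem _).2 (mem_ME.2 fun α hα => ht.lt_HE hα)

lemma map_mul_lt_one (ht : IsUniformizingRoot K v q t) {α : Γ₀ˣ} (hα : α ∈ HE K v) :
    v t * (α : Γ₀) < 1 := by
  have := ht.lt_HE (inv_mem hα)
  rwa [Units.val_inv_eq_inv_val, ← one_div, lt_div_iff₀ (zero_lt_iff.2 α.ne_zero)] at this

lemma mul_lt_HE (ht : IsUniformizingRoot K v q t) {x : L} {α β : Γ₀ˣ} (hα : α ∈ HE K v)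
    (hx : v x ≤ v t * (α : Γ₀)) (hβ : β ∈ HE K v) : v x < (β : Γ₀) := by
  have := ht.lt_HE (mul_mem hβ (inv_mem hα))
  rw [Units.val_mul, Units.val_inv_eq_inv_val, ← div_eq_mul_inv,
    lt_div_iff₀ (zero_lt_iff.2 α.ne_zero)] at this
  exact hx.trans_lt this

/-- One factor can absorb the whole coefficient from O_E: an element of t^(n+1) O_E is t^n times an
element of t O_E = M_E, which already lies in O_L. The exponent 0 is excluded because that power is
O_L, not O_E. -/
lemma mem_MEL_pow (ht : IsUniformizingRoot K v q t) {n : ℕ} (hn : n ≠ 0)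
    {x : v.valuationSubring} : x ∈ MEL K v ^ n ↔ (x : L) / t ^ n ∈ OE K v := by
  have h1 : ∀ y : v.valuationSubring, y ∈ MEL K v ↔ (y : L) / t ∈ OE K v := fun y => by
    rw [mem_MEL, div_mem_OE ht.ne_zero]
    exact ⟨ht.le_mul y, fun ⟨α, hα, h⟩ β hβ => ht.mul_lt_HE hα h hβ⟩
  induction n, Nat.one_le_iff_ne_zero.2 hn using Nat.le_induction generalizing x with
  | base => rw [pow_one, pow_one, h1]
  | succ n hn ih =>
    replace ih := fun x => ih (x := x) (by omega)
    constructor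
    · rw [pow_succ]
      intro hx
      induction hx using Submodule.mul_induction_on' with
      | mem_mul_mem a ha b hb =>
        have := mul_mem ((ih a).1 ha) ((h1 b).1 hb)
        rwa [div_mul_div_comm, ← pow_succ] at this
      | add a _ b _ ha hb =>
        have := add_mem ha hb
        rwa [← add_div] at this
    · intro hx
      let t' : v.valuationSubring := ⟨t, ht.lt_one.le⟩
      have htM : t' ∈ MEL K v := mem_MEL.2 fun α hα => ht.lt_HE hα
      have hxt : v ((x : L) / t ^ n) ≤ 1 := by
        obtain ⟨α, hα, h⟩ := (div_mem_OE (pow_ne_zero _ ht.ne_zero)).1 hx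
        have htn : 0 < v t ^ n := pow_pos ht.map_pos n
        rw [map_div₀, map_pow, div_le_iff₀ htn, one_mul]
        refine h.trans ?_
        rw [map_pow, pow_succ, mul_assoc]
        refine mul_le_of_le_one_right' (ht.map_mul_lt_one hα).le
      have hx' : x = t' ^ n * ⟨(x : L) / t ^ n, hxt⟩ :=
        Subtype.ext (mul_div_cancel₀ _ (pow_ne_zero _ ht.ne_zero)).symm
      rw [hx', pow_succ]
      refine Ideal.mul_mem_mul (Ideal.pow_mem_pow htM n) ((h1 _).2 ?_)
      rwa [div_div, ← pow_succ]

/-- The homogeneous parts of integral elements are multiples, in `O_E`, of powers of `t`. -/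
lemma coeff_mem_OE (ht : IsUniformizingRoot K v q t) (hq : q.Prime)
    (hram : (valK K v).relIndex (valL v) = q) {a : K} {i : ℕ} (hi : i < q)
    (ha : v (a • t ^ i) ≤ 1) : algebraMap K L a ∈ OE K v := by
  by_contra h
  rw [mem_OE] at h
  push Not at h
  have ha0 : algebraMap K L a ≠ 0 := by
    intro h0
    have := h 1 (one_mem _)
    simp [h0] at this
  have hapos : 0 < v (algebraMap K L a) := zero_lt_iff.2 (v.ne_zero_iff.2 ha0)
  have hy : ∀ α ∈ HE K v, v (algebraMap K L a)⁻¹ < (α : Γ₀) := fun α hα => by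
    have := h α⁻¹ (inv_mem hα)
    rw [Units.val_inv_eq_inv_val] at this
    rw [map_inv₀]
    exact (inv_lt_comm₀ (zero_lt_iff.2 α.ne_zero) hapos).1 this
  -- If a ∉ O_E, then a⁻¹ ∈ M_E = t O_E, and further factors t can be split off up to t^(i+1). This
  -- makes v (a t^i) > 1.
  have key : ∀ j ≤ i, ∃ α ∈ HE K v, v (algebraMap K L a)⁻¹ ≤ v (t ^ (j + 1)) * (α : Γ₀) := by
    intro j
    induction j with
    | zero => intro _; simpa using ht.le_mul _ hy
    | succ j ih =>
      intro hj
      have htj : t ^ (j + 1) ≠ 0 := pow_ne_zero _ ht.ne_zero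
      have htj' : v (t ^ (j + 1)) ≠ 0 := v.ne_zero_iff.2 htj
      obtain ⟨α, hα, hle⟩ := ih (by omega)
      set e := (algebraMap K L a)⁻¹ / t ^ (j + 1) with he
      have hve : v (algebraMap K L a)⁻¹ = v (t ^ (j + 1)) * v e := by
        rw [← map_mul, he, mul_div_cancel₀ _ htj]
      by_cases hM : ∀ β ∈ HE K v, v e < (β : Γ₀)
      · obtain ⟨β, hβ, hle'⟩ := ht.le_mul e hM
        refine ⟨β, hβ, ?_⟩
        rw [hve, pow_succ t (j + 1), map_mul, mul_assoc]
        exact mul_le_mul_right hle' _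
      · push Not at hM
        obtain ⟨β, hβ, hle'⟩ := hM
        have he0 : e ≠ 0 := div_ne_zero (inv_ne_zero ha0) htj
        -- Here v e ∈ H_E ≤ vK by convexity, so v (t^(j+1)) would lie in vK although 0 < j + 1 < q.
        obtain ⟨u, hu⟩ : ∃ u : Γ₀ˣ, (u : Γ₀) = v e := ⟨Units.mk0 _ (v.ne_zero_iff.2 he0), rfl⟩
        rw [hve] at hle
        have hle2 : v e ≤ α := le_of_mul_le_mul_left hle (zero_lt_iff.2 htj')
        obtain ⟨c, hc⟩ := exists_map_eq_of_mem_HE (HE_convex hβ hα (mem_valL.2 ⟨e, hu.symm⟩)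
          (Units.val_le_val.1 (hu ▸ hle')) (Units.val_le_val.1 (hu ▸ hle2)))
        have hc0 : v (algebraMap K L c) ≠ 0 := hc ▸ u.ne_zero
        refine absurd ?_ (ht.ramified.pow hq hram (n := j + 1)
          (Nat.not_dvd_of_pos_of_lt (by omega) (by omega)) (a⁻¹ / c))
        rw [map_div₀, map_div₀, map_inv₀, hve, div_eq_iff hc0, hc, hu, map_pow]
  obtain ⟨α, hα, hle⟩ := key i le_rfl
  have h2 := ht.map_mul_lt_one hα
  rw [Algebra.smul_def, map_mul] at ha
  have h3 : v (algebraMap K L a)⁻¹ ≤ v (algebraMap K L a)⁻¹ * (v t * (α : Γ₀)) := by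
    calc _ ≤ v (t ^ (i + 1)) * (α : Γ₀) := hle
      _ = v (algebraMap K L a)⁻¹ * ((v (algebraMap K L a) * v (t ^ i)) * (v t * (α : Γ₀))) := by
        rw [map_inv₀, ← mul_assoc, inv_mul_cancel_left₀ hapos.ne', pow_succ, map_mul, mul_assoc]
      _ ≤ v (algebraMap K L a)⁻¹ * (1 * (v t * (α : Γ₀))) := by gcongr
      _ = _ := by rw [one_mul]
  exact absurd h3 (not_le_of_gt
    (mul_lt_of_lt_one_right (zero_lt_iff.2 (v.ne_zero_iff.2 (inv_ne_zero ha0))) h2))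

lemma smul_pow_le_one (ht : IsUniformizingRoot K v q t) (hq : q.Prime)
    (hram : (valK K v).relIndex (valL v) = q) {x : v.valuationSubring} {a : Fin q → K}
    (ha : (x : L) = ∑ i, a i • t ^ (i : ℕ)) (i : Fin q) : v (a i • t ^ (i : ℕ)) ≤ 1 :=
  (ht.ramified.term_le_sum hq hram a i).trans (ha ▸ x.2)

/-- The coefficients of x in powers of t lie in O_E but perhaps not in O_K. Replacing t by w = c t
with v c ∈ H_E large makes them integral and also gives v b ≤ v w ^ (q-1), while w still has value <
1. -/
lemma MEL_pow_le_annihilator (ht : IsUniformizingRoot K v q t) (hq : q.Prime)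
    (hram : (valK K v).relIndex (valL v) = q) (hdeg : Module.finrank K L = q)
    (hq1 : v (q : L) = 1) : MEL K v ^ (q - 1) ≤ Module.annihilator v.valuationSubring
      (Ω[v.valuationSubring⁄(restr K v).valuationSubring]) := by
  have hq2 := hq.two_le
  intro b hb
  rw [ht.mem_MEL_pow (by omega), div_mem_OE (pow_ne_zero _ ht.ne_zero)] at hb
  obtain ⟨α, hα, hbα⟩ := hb
  rw [KaehlerDifferential.mem_annihilator_iff]
  intro x
  obtain ⟨a, ha⟩ := ht.ramified.exists_eq_sum hq hram hdeg (x : L)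
  have hle := ht.smul_pow_le_one hq hram ha
  choose β hβ haβ using fun i : Fin q => mem_OE.1 (ht.coeff_mem_OE hq hram i.2 (hle i))
  -- Collects 1, α and all β i, so that one γ ∈ H_E bounds them simultaneously.
  let f : Option (Option (Fin q)) → HE K v := fun o =>
    o.elim 1 fun o => o.elim ⟨α, hα⟩ fun i => ⟨β i, hβ i⟩
  obtain ⟨γ, hγ⟩ := Finset.exists_le (Finset.univ.image f)
  have hγf : ∀ o, f o ≤ γ := fun o => hγ _ (Finset.mem_image_of_mem _ (Finset.mem_univ o))
  have h1γ : (1 : Γ₀) ≤ ((γ : Γ₀ˣ) : Γ₀) := by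
    have : ((1 : HE K v) : Γ₀ˣ) ≤ γ := hγf none
    exact_mod_cast this
  have hαγ : (α : Γ₀) ≤ ((γ : Γ₀ˣ) : Γ₀) := Units.val_le_val.2 (hγf (some none))
  have hβγ : ∀ i, (β i : Γ₀) ≤ ((γ : Γ₀ˣ) : Γ₀) := fun i =>
    Units.val_le_val.2 (hγf (some (some i)))
  obtain ⟨c, hc⟩ := exists_map_eq_of_mem_HE γ.2
  have hc0 : algebraMap K L c ≠ 0 := v.ne_zero_iff.1 (hc ▸ (γ : Γ₀ˣ).ne_zero)
  have hcK : c ≠ 0 := by simpa using hc0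
  have hw : IsRamifiedRoot K v q (c • t) := by
    obtain ⟨s, hs⟩ := ht.pow_mem
    refine ⟨⟨c ^ q * s, by rw [map_mul, map_pow, hs, Algebra.smul_def, mul_pow]⟩, ?_⟩
    simpa using ht.ramified.smul_pow hq hram hcK (i := 1) hq.not_dvd_one
  have hvw : v (c • t) = v t * ((γ : Γ₀ˣ) : Γ₀) := by
    rw [Algebra.smul_def, map_mul, hc, mul_comm]
  have hw1 : v (c • t) < 1 := by
    simpa using ht.mul_lt_HE γ.2 hvw.le (one_mem _)
  have hcoef : ∀ i, v (algebraMap K L (a i * (c ^ (i : ℕ))⁻¹)) ≤ 1 := by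
    intro i
    rcases Nat.eq_zero_or_pos (i : ℕ) with h | h
    · simpa [h, Algebra.smul_def] using hle i
    · rw [map_mul, map_mul, map_inv₀, map_inv₀, map_pow, map_pow, hc, ← div_eq_mul_inv,
        div_le_iff₀ (pow_pos (zero_lt_iff.2 (γ : Γ₀ˣ).ne_zero) _), one_mul]
      exact (haβ i).trans ((hβγ i).trans (le_self_pow₀ h1γ h.ne'))
  have hterm : ∀ i : Fin q, (a i * (c ^ (i : ℕ))⁻¹) • (c • t) ^ (i : ℕ) = a i • t ^ (i : ℕ) :=
    fun i => by rw [smul_pow, smul_smul, inv_mul_cancel_right₀ (pow_ne_zero _ hcK)]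
  refine hw.smul_D_eq_zero hq1 hw1.le hcoef (by simp_rw [hterm]; exact ha) fun i hi => ?_
  have hb' : v (b : L) ≤ v (c • t) ^ (q - 1) := by
    refine hbα.trans ?_
    rw [hvw, mul_pow, map_pow]
    exact mul_le_mul_right (hαγ.trans (le_self_pow₀ h1γ (by omega))) _
  have hterm' : v ((a i * (c ^ (i : ℕ))⁻¹) • (c • t) ^ (i : ℕ)) ≤ v (c • t) := by
    rw [Algebra.smul_def, map_mul, map_pow]
    exact (mul_le_of_le_one_left' (hcoef i)).trans (pow_le_of_le_one zero_le hw1.le hi.ne')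
  calc _ ≤ v (c • t) ^ (q - 1) * v (c • t) := mul_le_mul' hb' hterm'
    _ = v (c • t) ^ q := by rw [← pow_succ, Nat.sub_add_cancel (by omega)]

end IsUniformizingRoot

end Uniformizing

/-! ### A derivation into O_L/M_E^q and the exact annihilator -/

section Derivation

variable {K L Γ₀ : Type*} [Field K] [Field L] [Algebra K L]
  [LinearOrderedCommGroupWithZero Γ₀] {v : Valuation L Γ₀} {q : ℕ}

namespace IsUniformizingRoot

variable {t : L}

/-- The Euler operator t d/dt on the basis 1, t, …, t^(q-1). Since t^q is a constant from K,
exponents matter modulo q, whence the remainder. -/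
lemma exists_linearMap (ht : IsUniformizingRoot K v q t) (hq : q.Prime)
    (hram : (valK K v).relIndex (valL v) = q) (hdeg : Module.finrank K L = q) :
    ∃ D : L →ₗ[K] L, ∀ n : ℕ, D (t ^ n) = ((n % q : ℕ) : L) * t ^ n := by
  have : Nonempty (Fin q) := ⟨⟨0, hq.pos⟩⟩
  let b := basisOfLinearIndependentOfCardEqFinrank (ht.ramified.linearIndependent hq hram)
    (by simp [hdeg])
  have hb : ∀ i, b i = t ^ (i : ℕ) := fun i => by simp [b]
  refine ⟨b.constr K fun i => ((i : ℕ) : L) * t ^ (i : ℕ), fun n => ?_⟩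
  obtain ⟨s, hs⟩ := ht.pow_mem
  have hn : t ^ n = s ^ (n / q) • b ⟨n % q, Nat.mod_lt _ hq.pos⟩ := by
    rw [hb, Algebra.smul_def, map_pow, hs, ← pow_mul, ← pow_add, Nat.div_add_mod]
  rw [hn, map_smul, Module.Basis.constr_basis, hb, mul_smul_comm]

/-- On monomials the Leibniz rule fails only through (i + j) % q ≠ i + j. This requires i + j ≥ q,
and then the defect contains the factor t^q, with coefficients in O_E by `coeff_mem_OE`. -/
lemma leibniz_div_mem (ht : IsUniformizingRoot K v q t) (hq : q.Prime)
    (hram : (valK K v).relIndex (valL v) = q) (hdeg : Module.finrank K L = q)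
    {D : L →ₗ[K] L} (hD : ∀ n : ℕ, D (t ^ n) = ((n % q : ℕ) : L) * t ^ n)
    (x y : v.valuationSubring) :
    (D (x * y) - (x * D y + y * D x)) / t ^ q ∈ OE K v := by
  obtain ⟨a, ha⟩ := ht.ramified.exists_eq_sum hq hram hdeg (x : L)
  obtain ⟨b, hb⟩ := ht.ramified.exists_eq_sum hq hram hdeg (y : L)
  have haO := fun i : Fin q => ht.coeff_mem_OE hq hram i.2 (ht.smul_pow_le_one hq hram ha i)
  have hbO := fun i : Fin q => ht.coeff_mem_OE hq hram i.2 (ht.smul_pow_le_one hq hram hb i)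
  have hsum : D (x * y) - (x * D y + y * D x) = ∑ i, ∑ j, algebraMap K L (a i) *
      algebraMap K L (b j) * ((((i + j : ℕ) % q : ℕ) : L) - ((i + j : ℕ) : L)) *
        t ^ (i + j : ℕ) := by
    have h1 : D (x * y) = ∑ i, ∑ j, algebraMap K L (a i) * algebraMap K L (b j) *
        ((((i + j : ℕ) % q : ℕ) : L) * t ^ (i + j : ℕ)) := by
      rw [ha, hb, Finset.sum_mul_sum, map_sum]
      refine Finset.sum_congr rfl fun i _ => ?_
      rw [map_sum]
      refine Finset.sum_congr rfl fun j _ => ?_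
      rw [smul_mul_smul_comm, ← pow_add, map_smul, hD, Algebra.smul_def, map_mul]
    have hDs : ∀ c : Fin q → K, D (∑ i, c i • t ^ (i : ℕ)) =
        ∑ i, algebraMap K L (c i) * ((i : ℕ) * t ^ (i : ℕ)) := fun c => by
      rw [map_sum]
      refine Finset.sum_congr rfl fun i _ => ?_
      rw [map_smul, hD, Nat.mod_eq_of_lt i.2, Algebra.smul_def]
    have h2 : (x : L) * D y = ∑ i, ∑ j, algebraMap K L (a i) * algebraMap K L (b j) *
        ((j : ℕ) * t ^ (i + j : ℕ)) := by
      rw [ha, hb, hDs, Finset.sum_mul_sum]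
      refine Finset.sum_congr rfl fun i _ => Finset.sum_congr rfl fun j _ => ?_
      rw [Algebra.smul_def, pow_add]; ring
    have h3 : (y : L) * D x = ∑ i, ∑ j, algebraMap K L (a i) * algebraMap K L (b j) *
        ((i : ℕ) * t ^ (i + j : ℕ)) := by
      rw [ha, hb, hDs, mul_comm, Finset.sum_mul_sum]
      refine Finset.sum_congr rfl fun i _ => Finset.sum_congr rfl fun j _ => ?_
      rw [Algebra.smul_def, pow_add]; ring
    rw [h1, h2, h3, ← Finset.sum_add_distrib, ← Finset.sum_sub_distrib]
    refine Finset.sum_congr rfl fun i _ => ?_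
    rw [← Finset.sum_add_distrib, ← Finset.sum_sub_distrib]
    refine Finset.sum_congr rfl fun j _ => ?_
    push_cast; ring
  rw [hsum, Finset.sum_div]
  refine sum_mem fun i _ => ?_
  rw [Finset.sum_div]
  refine sum_mem fun j _ => ?_
  rcases lt_or_ge (i + j : ℕ) q with h | h
  · rw [Nat.mod_eq_of_lt h, sub_self, mul_zero, zero_mul, zero_div]
    exact zero_mem _
  · rw [mul_div_assoc, div_eq_mul_inv (t ^ _), ← pow_sub₀ t ht.ne_zero h]
    exact mul_mem (mul_mem (mul_mem (haO i) (hbO j))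
      (sub_mem (natCast_mem _ _) (natCast_mem _ _))) (pow_mem (mem_OE_of_le ht.lt_one.le) _)

lemma map_mem (ht : IsUniformizingRoot K v q t) (hq : q.Prime)
    (hram : (valK K v).relIndex (valL v) = q) (hdeg : Module.finrank K L = q)
    {D : L →ₗ[K] L} (hD : ∀ n : ℕ, D (t ^ n) = ((n % q : ℕ) : L) * t ^ n)
    (x : v.valuationSubring) : D x ∈ v.valuationSubring := by
  obtain ⟨a, ha⟩ := ht.ramified.exists_eq_sum hq hram hdeg (x : L)
  rw [ha, map_sum]
  refine sum_mem fun i _ => ?_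
  rw [map_smul, hD, ← mul_smul_comm]
  exact mul_mem (natCast_mem _ _) (ht.smul_pow_le_one hq hram ha i)

/-- The derivation `a t ^ i ↦ i a t ^ i` of `O_L` modulo `M_E ^ q`. -/
lemma exists_derivation (ht : IsUniformizingRoot K v q t) (hq : q.Prime)
    (hram : (valK K v).relIndex (valL v) = q) (hdeg : Module.finrank K L = q) :
    ∃ δ : Derivation (restr K v).valuationSubring v.valuationSubring
      (v.valuationSubring ⧸ MEL K v ^ q),
      δ ⟨t, ht.lt_one.le⟩ = Ideal.Quotient.mk _ ⟨t, ht.lt_one.le⟩ := by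
  obtain ⟨D, hD⟩ := ht.exists_linearMap hq hram hdeg
  let E : v.valuationSubring → v.valuationSubring := fun x => ⟨D x, ht.map_mem hq hram hdeg hD x⟩
  let l : v.valuationSubring →ₗ[(restr K v).valuationSubring] (v.valuationSubring ⧸ MEL K v ^ q) :=
    { toFun := fun x => Ideal.Quotient.mk _ (E x)
      map_add' := fun x y => by
        rw [← map_add]
        exact congr_arg _ (Subtype.ext (map_add D (x : L) y))
      map_smul' := fun c x => by
        have hE : E (c • x) = c • E x := by
          apply Subtype.ext
          have h1 : ∀ z : v.valuationSubring, ((c • z : v.valuationSubring) : L) = (c : K) • (z : L) :=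
            fun z => by rw [Algebra.smul_def, Algebra.smul_def]; rfl
          rw [h1]
          simp only [E, h1, map_smul]
        rw [hE]
        rfl }
  refine ⟨Derivation.mk' l fun x y => ?_, ?_⟩
  · change Ideal.Quotient.mk _ (E (x * y)) =
      Ideal.Quotient.mk _ (x * E y) + Ideal.Quotient.mk _ (y * E x)
    rw [← map_add, Ideal.Quotient.eq, ht.mem_MEL_pow hq.ne_zero]
    exact ht.leibniz_div_mem hq hram hdeg hD x y
  · refine congr_arg (Ideal.Quotient.mk _) (Subtype.ext ?_)
    have := hD 1
    rw [Nat.mod_eq_of_lt hq.one_lt] at this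
    simpa using this

/-- Applying the derivation to b dt = 0 gives bt ∈ M_E^q = t^q O_E ∩ O_L; cancelling one t leaves b
∈ M_E^(q-1). -/
lemma annihilator_eq (ht : IsUniformizingRoot K v q t) (hq : q.Prime)
    (hram : (valK K v).relIndex (valL v) = q) (hdeg : Module.finrank K L = q)
    (hq1 : v (q : L) = 1) : Module.annihilator v.valuationSubring
      (Ω[v.valuationSubring⁄(restr K v).valuationSubring]) = MEL K v ^ (q - 1) := by
  refine le_antisymm (fun b hb => ?_) (ht.MEL_pow_le_annihilator hq hram hdeg hq1)
  have hq2 := hq.two_le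
  obtain ⟨δ, hδ⟩ := ht.exists_derivation hq hram hdeg
  have h := KaehlerDifferential.mem_annihilator_iff.1 hb ⟨t, ht.lt_one.le⟩
  apply_fun δ.liftKaehlerDifferential at h
  rw [map_smul, map_zero, Derivation.liftKaehlerDifferential_comp_D, hδ] at h
  change Ideal.Quotient.mk _ (b * _) = 0 at h
  rw [Ideal.Quotient.eq_zero_iff_mem, ht.mem_MEL_pow hq.ne_zero] at h
  rw [ht.mem_MEL_pow (by omega)]
  obtain ⟨n, rfl⟩ : ∃ n, q = n + 1 := ⟨q - 1, by omega⟩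
  simpa [pow_succ, mul_div_mul_right _ _ ht.ne_zero] using h

/-- For q > 2, equality would place t in t^(q-1) O_E ⊆ t² O_E, making t a unit of O_E. -/
lemma MEL_pow_eq_maximalIdeal_iff (ht : IsUniformizingRoot K v q t) (hq : q.Prime) :
    MEL K v ^ (q - 1) = IsLocalRing.maximalIdeal v.valuationSubring ↔
      q = 2 ∧ MEL K v = IsLocalRing.maximalIdeal v.valuationSubring := by
  have hq2 := hq.two_le
  refine ⟨fun h => ?_, fun ⟨h2, h⟩ => by subst h2; simpa using h⟩
  have hle : MEL K v ≤ IsLocalRing.maximalIdeal v.valuationSubring :=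
    IsLocalRing.le_maximalIdeal (Ideal.IsPrime.ne_top (ValuationSubring.prime_idealOfLE _ _ _))
  have heq : MEL K v = IsLocalRing.maximalIdeal v.valuationSubring :=
    le_antisymm hle (h ▸ Ideal.pow_le_self (by omega))
  refine ⟨?_, heq⟩
  by_contra hne
  have htM : (⟨t, ht.lt_one.le⟩ : v.valuationSubring) ∈ MEL K v :=
    mem_MEL.2 fun α hα => ht.lt_HE hα
  rw [heq, ← h, ht.mem_MEL_pow (by omega), div_mem_OE (pow_ne_zero _ ht.ne_zero)] at htM
  obtain ⟨α, hα, h3⟩ := htM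
  have h4 : v t ^ (q - 1) ≤ v t * v t := by
    rw [← sq]
    exact pow_le_pow_right_of_le_one' ht.lt_one.le (by omega)
  rw [map_pow] at h3
  have h5 : v t * 1 ≤ v t * (v t * (α : Γ₀)) := by
    rw [mul_one, ← mul_assoc]
    exact h3.trans (mul_le_mul_left h4 _)
  exact (ht.map_mul_lt_one hα).not_ge (le_of_mul_le_mul_left h5 ht.map_pos)

end IsUniformizingRoot

end Derivation

end ValuedExt

theorem mainTheorem7 (K L Γ₀ : Type*) [Field K] [Field L] [Algebra K L]
    [LinearOrderedCommGroupWithZero Γ₀] (v : Valuation L Γ₀) (q : ℕ) (hq : q.Prime)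
    (hkum : ValuedExt.IsKummer K L q)
    (hram : (ValuedExt.valK K v).relIndex (ValuedExt.valL v) = q)
    (hchar : q ≠ ringChar (IsLocalRing.ResidueField (ValuedExt.restr K v).valuationSubring))
    (hΩ : Nontrivial (Ω[v.valuationSubring⁄(ValuedExt.restr K v).valuationSubring])) :
    (ValuedExt.ME K v).IsPrincipal ∧
    Module.annihilator v.valuationSubring
        (Ω[v.valuationSubring⁄(ValuedExt.restr K v).valuationSubring]) = ValuedExt.MEL K v ^ (q - 1) ∧
    (Module.annihilator v.valuationSubring
        (Ω[v.valuationSubring⁄(ValuedExt.restr K v).valuationSubring]) =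
          IsLocalRing.maximalIdeal v.valuationSubring ↔
      q = 2 ∧ ValuedExt.MEL K v = IsLocalRing.maximalIdeal v.valuationSubring) := by
  have hq1 := ValuedExt.map_natCast_eq_one K hq hchar
  obtain ⟨η, hη⟩ := ValuedExt.exists_isRamifiedRoot hq hkum hram hq1
  obtain ⟨t, ht⟩ := hη.exists_isUniformizingRoot hq hram hkum.degree hq1 hΩ
  have hann := ht.annihilator_eq hq hram hkum.degree hq1
  exact ⟨ht.isPrincipal_ME, hann, hann ▸ ht.MEL_pow_eq_maximalIdeal_iff hq⟩
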